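/- Let $\mathbb K$ be $\mathbb R$ or $\mathbb C$, let $X$ be a metric space with base point $0$, and let $E$ be a Banach space over $\mathbb K$. For a normed space $G$, $Lip_0(X;G)$ is the set of Lipschitz maps $g:X\to G$ with $g(0)=0$, $Lip(g)=\sup_{x\neq y}\|g(x)-g(y)\|/d(x,y)$, and $B_{X^\#}$ is the set of $f\in Lip_0(X;\mathbb K)$ with $Lip(f)\le 1$. A map $R:X\to E$ is *Lipschitz Grothendieck-integral* ($R\in Lip_{0GI}(X;E)$) if $R\in Lip_0(X;E)$ and there are a finite measure space $(\Omega,\Sigma,\mu)$, a map $g\in Lip_0(X;L_\infty(\mu))$ and a bounded linear operator $A:L_1(\mu)\to E^{**}$ with $\kappa_E\circ R=A\circ I_{\infty,1}\circ g$, where $\kappa_E:E\to E^{**}$ is the canonical embedding and $I_{\infty,1}:L_\infty(\mu)\to L_1(\mu)$ is the inclusion. Then $Lip_{GI}(R)$ is the infimum of $\|A\|\,\mu(\Omega)\,Lip(g)$ over all such factorizations. For Banach spaces $G,F$, let $LipL_0(X\times G;F)$ be the set of maps $T:X\times G\to F$ that are linear in the second variable, vanish on $\{0\}\times G$, and satisfy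 $\|T(x,e)-T(y,e)\|\le C\,d(x,y)\|e\|$ for some $C>0$ and all $x,y\in X$, $e\in G$. Such a $T$ is *integral* if there is $C>0$ such that for all $n$, all $x_1,\dots,x_n,y_1,\dots,y_n\in X$, $e_1,\dots,e_n\in G$ and $z_1^*,\dots,z_n^*\in F^*$, $$\Bigl|\sum_{i=1}^n\langle T(x_i,e_i)-T(y_i,e_i),z_i^*\rangle\Bigr|\le C\sup_{f\in B_{X^\#},\ e^*\in G^*,\ \|e^*\|=1}\Bigl\|\sum_{i=1}^n (f(x_i)-f(y_i))\,e^*(e_i)\,z_i^*\Bigr\|_{F^*}$$ (a supremum over the empty set being $0$), and $\mathfrak I^{LipL}_{int}(T)$ is the infimum of these $C$. **Proposition.** Let $R:X\to E$ be a Lipschitz map and let $T_R:X\times E^*\to\mathbb K$, $T_R(x,e^*)=e^*(R(x))$. The following are equivalent: 1. $R\in Lip_{0GI}(X;E)$. 2. $T_R\in LipL_0(X\times E^*;\mathbb K)$ and $T_R$ is integral. In this case, $Lip_{GI}(R)=\mathfrak I^{LipL}_{int}(T_R)$. -/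

import Mathlib

open MeasureTheory
open scoped ENNReal

universe u v w

noncomputable section

namespace LipLin

/-- The Lipschitz number `Lip(g) = sup_{x ≠ y} ‖g x - g y‖ / d(x, y)` of a map `g` from a metric
space into a normed space (a real number when `g` is Lipschitz). -/
def lipNumber {X G : Type*} [MetricSpace X] [NormedAddCommGroup G] (g : X → G) : ℝ :=
  sSup {r : ℝ | ∃ x y : X, x ≠ y ∧ r = ‖g x - g y‖ / dist x y}

/-- `g ∈ Lip₀(X; G)`: the map `g` is Lipschitz and sends the base point `o` of `X` to `0`. -/
def IsLipZero {X G : Type*} [MetricSpace X] [NormedAddCommGroup G] (o : X) (g : X → G) : Prop :=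
  (∃ K, LipschitzWith K g) ∧ g o = 0

/-- The inclusion `I_{∞,1} : L_∞(μ) → L_1(μ)` for a finite measure `μ`. -/
def linftyToL1 {𝕜 Ω : Type*} [RCLike 𝕜] [MeasurableSpace Ω] (μ : Measure Ω) [IsFiniteMeasure μ]
    (h : Lp 𝕜 ∞ μ) : Lp 𝕜 1 μ :=
  ((Lp.memLp h).mono_exponent le_top).toLp (h : Ω → 𝕜)

/-- `κ_E ∘ R = A ∘ I_{∞,1} ∘ g` with `g ∈ Lip₀(X; L_∞(μ))` and `A : L_1(μ) → E**` bounded and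
linear, where `κ_E : E → E**` is the canonical embedding. -/
def IsGIFactorization {𝕜 : Type w} {X : Type u} {E : Type v} [RCLike 𝕜] [MetricSpace X]
    [NormedAddCommGroup E] [NormedSpace 𝕜 E] (o : X) (R : X → E)
    {Ω : Type (max u v w)} [MeasurableSpace Ω] (μ : Measure Ω) [IsFiniteMeasure μ]
    (g : X → Lp 𝕜 ∞ μ) (A : Lp 𝕜 1 μ →L[𝕜] StrongDual 𝕜 (StrongDual 𝕜 E)) : Prop :=
  IsLipZero o g ∧
    ∀ x, NormedSpace.inclusionInDoubleDual 𝕜 E (R x) = A (linftyToL1 μ (g x))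

/-- `R ∈ Lip_{0GI}(X; E)`: the map `R` is Lipschitz Grothendieck-integral. -/
def IsLipGI (𝕜 : Type w) {X : Type u} {E : Type v} [RCLike 𝕜] [MetricSpace X]
    [NormedAddCommGroup E] [NormedSpace 𝕜 E] (o : X) (R : X → E) : Prop :=
  IsLipZero o R ∧
    ∃ (Ω : Type (max u v w)) (_ : MeasurableSpace Ω) (μ : Measure Ω) (_ : IsFiniteMeasure μ)
      (g : X → Lp 𝕜 ∞ μ) (A : Lp 𝕜 1 μ →L[𝕜] StrongDual 𝕜 (StrongDual 𝕜 E)),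
      IsGIFactorization o R μ g A

set_option maxSynthPendingDepth 4 in
/-- `Lip_{GI}(R)`: the infimum of `‖A‖ μ(Ω) Lip(g)` over all factorizations
`κ_E ∘ R = A ∘ I_{∞,1} ∘ g`. -/
def lipGINorm (𝕜 : Type w) {X : Type u} {E : Type v} [RCLike 𝕜] [MetricSpace X]
    [NormedAddCommGroup E] [NormedSpace 𝕜 E] (o : X) (R : X → E) : ℝ :=
  sInf {c : ℝ | ∃ (Ω : Type (max u v w)) (_ : MeasurableSpace Ω) (μ : Measure Ω)
      (_ : IsFiniteMeasure μ) (g : X → Lp 𝕜 ∞ μ)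
      (A : Lp 𝕜 1 μ →L[𝕜] StrongDual 𝕜 (StrongDual 𝕜 E)),
      IsGIFactorization o R μ g A ∧ c = ‖A‖ * μ.real Set.univ * lipNumber g}

/-- `T ∈ LipL₀(X × E; F)`: `T` is Lip-Linear and `T(o, e) = 0` for all `e`. -/
def IsLipLinearZero (𝕜 : Type*) {X E F : Type*} [RCLike 𝕜] [MetricSpace X]
    [NormedAddCommGroup E] [NormedSpace 𝕜 E] [NormedAddCommGroup F] [NormedSpace 𝕜 F]
    (o : X) (T : X × E → F) : Prop :=
  (∃ C : ℝ, 0 < C ∧ ∀ x y e, ‖T (x, e) - T (y, e)‖ ≤ C * dist x y * ‖e‖) ∧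
    (∀ x, IsLinearMap 𝕜 fun e => T (x, e)) ∧ ∀ e, T (o, e) = 0

/-- The supremum of `‖∑ i, (f (xᵢ) - f (yᵢ)) e*(eᵢ) zᵢ*‖` over all `f` in the closed unit ball of
`X^# = Lip₀(X; 𝕜)` and all `e* ∈ E*` with `‖e*‖ = 1`. -/
def weakSup {𝕜 X E F : Type*} [RCLike 𝕜] [MetricSpace X]
    [NormedAddCommGroup E] [NormedSpace 𝕜 E] [NormedAddCommGroup F] [NormedSpace 𝕜 F]
    (o : X) {n : ℕ} (x y : Fin n → X) (e : Fin n → E) (z : Fin n → StrongDual 𝕜 F) : ℝ :=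
  sSup {r : ℝ | ∃ (f : X → 𝕜) (φ : StrongDual 𝕜 E), f o = 0 ∧ LipschitzWith 1 f ∧ ‖φ‖ = 1 ∧
    r = ‖∑ i, ((f (x i) - f (y i)) * φ (e i)) • z i‖}

/-- The constant `C` satisfies the inequality that defines integrality of `T`. -/
def IsIntegralBound (𝕜 : Type*) {X E F : Type*} [RCLike 𝕜] [MetricSpace X]
    [NormedAddCommGroup E] [NormedSpace 𝕜 E] [NormedAddCommGroup F] [NormedSpace 𝕜 F]
    (o : X) (T : X × E → F) (C : ℝ) : Prop :=
  ∀ (n : ℕ) (x y : Fin n → X) (e : Fin n → E) (z : Fin n → StrongDual 𝕜 F),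
    ‖∑ i, z i (T (x i, e i) - T (y i, e i))‖ ≤ C * weakSup o x y e z

/-- `T ∈ LipL₀^int(X × E; F)`: the Lip-Linear operator `T` is integral. -/
def IsIntegral (𝕜 : Type*) {X E F : Type*} [RCLike 𝕜] [MetricSpace X]
    [NormedAddCommGroup E] [NormedSpace 𝕜 E] [NormedAddCommGroup F] [NormedSpace 𝕜 F]
    (o : X) (T : X × E → F) : Prop :=
  IsLipLinearZero 𝕜 o T ∧ ∃ C : ℝ, 0 < C ∧ IsIntegralBound 𝕜 o T C

/-- The integral norm `𝔍_int^LipL(T)`: the infimum of the constants in the definition. -/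
def integralNorm (𝕜 : Type*) {X E F : Type*} [RCLike 𝕜] [MetricSpace X]
    [NormedAddCommGroup E] [NormedSpace 𝕜 E] [NormedAddCommGroup F] [NormedSpace 𝕜 F]
    (o : X) (T : X × E → F) : ℝ :=
  sInf {C : ℝ | 0 < C ∧ IsIntegralBound 𝕜 o T C}

/-- The form `T_R : X × E* → 𝕜`, `T_R (x, e*) = e* (R x)`. -/
def lipLinearForm (𝕜 : Type*) {X E : Type*} [RCLike 𝕜] [NormedAddCommGroup E] [NormedSpace 𝕜 E]
    (R : X → E) : X × StrongDual 𝕜 E → 𝕜 :=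
  fun p => p.2 (R p.1)

end LipLin

end

/-! Given a factorization through `g` and `A`, each measurable `S` of positive measure yields the
average of `g` over `S`, a scalar Lipschitz function, and the functional `A(1_S)/μ(S)` on `E*`. Up
to the factors `Lip(g)` and `‖A‖` these are competitors in `weakSup`. Approximating finitely many L₁
functions by simple ones on a common partition and summing over its cells gives the integral bound
with constant `‖A‖ μ(Ω) Lip(g)` (`norm_sum_apply_le`, `IsGIFactorization.isIntegralBound`).

Conversely, let `K` be the compact product of the unit balls of `X^#` (pointwise topology) and `E**`
(weak-*). Integrality with constant `C` bounds the functional `∑ v (x, e*) ↦ ∑ v e*(R x)` by `C`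
times the sup norm on `K` of `∑ v f(x) φ(e*)`. Hahn–Banach and Riesz replace this by an L₁(μ) norm
with `μ(K) ≤ C` (`exists_measure_dominating`), so the functional extends to a contraction `ψ` on
L₁(μ). Take `g(x)` to be evaluation at `x` and `A(k)(e*) = ψ(k · e*)`, with `‖A‖, Lip(g) ≤ 1`.
Neither direction loses in the constant, hence the equality of norms. -/

namespace LipLin

/-! ### Lipschitz numbers -/

section Basics

variable {X G : Type*} [MetricSpace X] [NormedAddCommGroup G]

lemma lipNumber_nonneg (g : X → G) : 0 ≤ lipNumber g := by
  apply Real.sSup_nonneg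
  rintro r ⟨x, y, -, rfl⟩
  positivity

lemma lipNumber_le {g : X → G} {K : ℝ} (hK : 0 ≤ K) (h : ∀ x y, ‖g x - g y‖ ≤ K * dist x y) :
    lipNumber g ≤ K := by
  refine Real.sSup_le ?_ hK
  rintro r ⟨x, y, hxy, rfl⟩
  exact (div_le_iff₀ (dist_pos.2 hxy)).2 (h x y)

lemma norm_sub_le_lipNumber_mul {g : X → G} (hg : ∃ K, LipschitzWith K g) (x y : X) :
    ‖g x - g y‖ ≤ lipNumber g * dist x y := by
  rcases eq_or_ne x y with rfl | hxy
  · simp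
  obtain ⟨K, hK⟩ := hg
  rw [← div_le_iff₀ (dist_pos.2 hxy)]
  refine le_csSup ⟨K, ?_⟩ ⟨x, y, hxy, rfl⟩
  rintro r ⟨x, y, hxy, rfl⟩
  rw [div_le_iff₀ (dist_pos.2 hxy), ← dist_eq_norm]
  exact hK.dist_le_mul x y

end Basics

/-! ### Homogeneity of the weak supremum -/

section WeakSup

variable {𝕜 X E F : Type*} [RCLike 𝕜] [MetricSpace X] [NormedAddCommGroup E] [NormedSpace 𝕜 E]
  [NormedAddCommGroup F] [NormedSpace 𝕜 F] (o : X) {n : ℕ} (x y : Fin n → X) (e : Fin n → E)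
  (z : Fin n → StrongDual 𝕜 F)

lemma weakSup_nonneg : 0 ≤ weakSup o x y e z := by
  apply Real.sSup_nonneg
  rintro r ⟨f, φ, -, -, -, rfl⟩
  positivity

lemma le_weakSup {f : X → 𝕜} {φ : StrongDual 𝕜 E} (hf0 : f o = 0) (hf : LipschitzWith 1 f)
    (hφ : ‖φ‖ = 1) :
    ‖∑ i, ((f (x i) - f (y i)) * φ (e i)) • z i‖ ≤ weakSup o x y e z := by
  refine le_csSup ⟨∑ i, dist (x i) (y i) * ‖e i‖ * ‖z i‖, ?_⟩ ⟨f, φ, hf0, hf, hφ, rfl⟩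
  rintro r ⟨f, φ, -, hf, hφ, rfl⟩
  refine norm_sum_le_of_le _ fun i _ => ?_
  rw [norm_smul, norm_mul]
  have h1 : ‖f (x i) - f (y i)‖ ≤ dist (x i) (y i) := by
    simpa [dist_eq_norm] using hf.dist_le_mul (x i) (y i)
  have h2 : ‖φ (e i)‖ ≤ ‖e i‖ := by simpa [hφ] using φ.le_opNorm (e i)
  gcongr

/-- Rescale `f` by `L⁻¹` and `φ` by `‖φ‖⁻¹`. The cases `L = 0` and `φ = 0` make the sum vanish; the
latter also covers a trivial dual, where the supremum is over the empty set. -/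
lemma norm_sum_le_mul_weakSup {f : X → 𝕜} {φ : StrongDual 𝕜 E} {L M : ℝ} (hL : 0 ≤ L)
    (hf0 : f o = 0) (hf : ∀ a b, ‖f a - f b‖ ≤ L * dist a b) (hφ : ‖φ‖ ≤ M) :
    ‖∑ i, ((f (x i) - f (y i)) * φ (e i)) • z i‖ ≤ L * M * weakSup o x y e z := by
  have hM : 0 ≤ M := (norm_nonneg φ).trans hφ
  have hW := weakSup_nonneg o x y e z
  rcases hL.eq_or_lt with rfl | hL
  · have h0 : ∀ a b, f a - f b = 0 := fun a b => by simpa using hf a b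
    rw [Finset.sum_eq_zero fun i _ => by rw [h0, zero_mul]; exact zero_smul 𝕜 (z i)]
    simp
  rcases eq_or_ne φ 0 with rfl | hφ0
  · rw [Finset.sum_eq_zero fun i _ => by
      rw [zero_apply, mul_zero]; exact zero_smul 𝕜 (z i), norm_zero]
    positivity
  have hL' : (L : 𝕜) ≠ 0 := by exact_mod_cast hL.ne'
  have hN' : ((‖φ‖ : ℝ) : 𝕜) ≠ 0 := by exact_mod_cast (norm_ne_zero_iff.2 hφ0)
  have key := le_weakSup o x y e z (f := fun a => (L : 𝕜)⁻¹ * f a)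
    (φ := ((‖φ‖ : ℝ) : 𝕜)⁻¹ • φ) (by simp [hf0]) ?_ ?_
  · have : ∑ i, ((f (x i) - f (y i)) * φ (e i)) • z i = ((L : 𝕜) * ((‖φ‖ : ℝ) : 𝕜)) •
        ∑ i, (((L : 𝕜)⁻¹ * f (x i) - (L : 𝕜)⁻¹ * f (y i)) *
          (((‖φ‖ : ℝ) : 𝕜)⁻¹ • φ) (e i)) • z i := by
      rw [Finset.smul_sum]
      refine Finset.sum_congr rfl fun i _ => ?_
      rw [smul_smul]
      congr 1
      simp only [smul_apply, smul_eq_mul]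
      field_simp
    rw [this, norm_smul, norm_mul, RCLike.norm_ofReal, RCLike.norm_ofReal, abs_of_pos hL, abs_norm]
    gcongr
  · refine LipschitzWith.of_dist_le_mul fun a b => ?_
    rw [dist_eq_norm, ← mul_sub, norm_mul, norm_inv, RCLike.norm_ofReal, abs_of_pos hL,
      NNReal.coe_one, one_mul, inv_mul_le_iff₀ hL]
    exact hf a b
  · rw [norm_smul, norm_inv, RCLike.norm_ofReal, abs_norm, inv_mul_cancel₀ (norm_ne_zero_iff.2 hφ0)]

end WeakSup

/-! ### Reduction from L₁ functions to averages over sets -/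

section Forward

variable {𝕜 Ω : Type*} [RCLike 𝕜] [MeasurableSpace Ω] {μ : Measure Ω}

lemma Lp_coeFn_sum {G ι : Type*} [NormedAddCommGroup G] {p : ℝ≥0∞} (s : Finset ι)
    (f : ι → Lp G p μ) : ⇑(∑ c ∈ s, f c) =ᵐ[μ] fun ω => ∑ c ∈ s, f c ω := by
  classical
  induction s using Finset.induction_on with
  | empty =>
    filter_upwards [Lp.coeFn_zero G p μ] with ω h
    simpa using h
  | insert c s hc ih =>
    rw [Finset.sum_insert hc]
    filter_upwards [Lp.coeFn_add (f c) (∑ c ∈ s, f c), ih] with ω h h'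
    rw [h, Finset.sum_insert hc, Pi.add_apply, h']

lemma ae_norm_le_norm_Lp_top {G : Type*} [NormedAddCommGroup G] (h : Lp G ∞ μ) :
    ∀ᵐ ω ∂μ, ‖h ω‖ ≤ ‖h‖ := by
  have h1 : ∀ᵐ ω ∂μ, ‖h ω‖ₑ ≤ eLpNorm h ∞ μ := ae_le_eLpNormEssSup
  filter_upwards [h1] with ω hω
  rw [Lp.norm_def, ← toReal_enorm]
  exact ENNReal.toReal_mono (Lp.eLpNorm_ne_top h) hω

lemma sum_setIntegral_fiber {G : Type*} (s : SimpleFunc Ω G) {f : Ω → ℝ} (hf : Integrable f μ) :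
    ∑ c ∈ s.range, ∫ ω in s ⁻¹' {c}, f ω ∂μ = ∫ ω, f ω ∂μ := by
  rw [← integral_biUnion_finset s.range (fun c _ => s.measurableSet_fiber c)
    (fun c _ d _ hcd => (Set.disjoint_singleton.2 hcd).preimage _) (fun c _ => hf.integrableOn)]
  have : ⋃ c ∈ s.range, s ⁻¹' {c} = Set.univ := by
    ext ω; simp
  rw [this, setIntegral_univ]

variable [IsFiniteMeasure μ]

lemma norm_sum_apply_simple_approx {H : Type*} [NormedAddCommGroup H] [NormedSpace 𝕜 H] {n : ℕ}
    (F : Fin n → Lp 𝕜 1 μ) (e : Fin n → H) (A : Lp 𝕜 1 μ →L[𝕜] StrongDual 𝕜 H) {B : ℝ}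
    (hB : ∀ (S : Set Ω) (hS : MeasurableSet S),
      ‖∑ i, (⨍ ω in S, F i ω ∂μ) * A (indicatorConstLp 1 hS (measure_ne_top μ S) 1) (e i)‖
        ≤ B * μ.real S) {ε : ℝ} (hε : 0 < ε) :
    ‖∑ i, A (F i) (e i)‖ ≤ B * μ.real Set.univ + ∑ i, ‖A‖ * ‖e i‖ * (2 * ε) := by
  have hF : ∀ i, Integrable (F i) μ := fun i => L1.integrable_coeFn (F i)
  -- Approximating the whole tuple as one vector-valued function gives a single partition, the
  -- fibers of `s`, that serves every `i`.
  have hFm : MemLp (fun ω i => F i ω) 1 μ := memLp_one_iff_integrable.2 (Integrable.of_eval hF)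
  obtain ⟨s, hs, -⟩ := hFm.exists_simpleFunc_eLpNorm_sub_lt ENNReal.one_ne_top
    (ENNReal.ofReal_pos.2 hε).ne'
  have hsint : Integrable s μ := s.integrable_of_isFiniteMeasure
  have hd : Integrable ((fun ω i => F i ω) - ⇑s) μ := (Integrable.of_eval hF).sub hsint
  have hsε : ∀ i, ∫ ω, ‖F i ω - s ω i‖ ∂μ ≤ ε := by
    intro i
    calc ∫ ω, ‖F i ω - s ω i‖ ∂μ ≤ ∫ ω, ‖((fun ω i => F i ω) - ⇑s) ω‖ ∂μ := by
          refine integral_mono ((hF i).sub (hsint.eval i)).norm hd.norm fun ω => ?_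
          exact norm_le_pi_norm (((fun ω i => F i ω) - ⇑s) ω) i
      _ ≤ ε := by
          rw [integral_norm_eq_lintegral_enorm hd.aestronglyMeasurable,
            ← eLpNorm_one_eq_lintegral_enorm]
          exact ENNReal.toReal_le_of_le_ofReal hε.le hs.le
  set u : (Fin n → 𝕜) → Lp 𝕜 1 μ := fun c =>
    indicatorConstLp 1 (s.measurableSet_fiber c) (measure_ne_top μ _) 1 with hu
  have hunorm : ∀ c, ‖u c‖ = μ.real (s ⁻¹' {c}) := fun c => by
    rw [hu, norm_indicatorConstLp one_ne_zero ENNReal.one_ne_top]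
    simp
  -- The hypothesis `hB` concerns true averages of `F i`, so the values `c i` of `s` must be traded
  -- for them; `havg` controls the price.
  set a : (Fin n → 𝕜) → Fin n → 𝕜 := fun c i => ⨍ ω in s ⁻¹' {c}, F i ω ∂μ with ha
  have hsum : ∀ i, ⇑(∑ c ∈ s.range, c i • u c) =ᵐ[μ] fun ω => s ω i := by
    intro i
    have h1 : ∀ᵐ ω ∂μ, ∀ c ∈ s.range, (c i • u c) ω
        = c i * (s ⁻¹' {c}).indicator (fun _ => (1 : 𝕜)) ω := by
      rw [Filter.eventually_all_finset]
      intro c _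
      filter_upwards [Lp.coeFn_smul (c i) (u c),
        indicatorConstLp_coeFn (hs := s.measurableSet_fiber c) (hμs := measure_ne_top μ _)
          (c := (1 : 𝕜)) (p := 1)] with ω h h'
      rw [h, Pi.smul_apply, smul_eq_mul, hu, h']
    filter_upwards [Lp_coeFn_sum s.range fun c => c i • u c, h1] with ω h h1
    rw [h, Finset.sum_congr rfl h1, Finset.sum_eq_single (s ω)]
    · simp
    · intro c _ hc
      rw [Set.indicator_of_notMem (by simpa using hc.symm), mul_zero]
    · intro h; simp at h
  have hdist : ∀ i, ‖F i - ∑ c ∈ s.range, c i • u c‖ ≤ ε := by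
    intro i
    rw [L1.norm_eq_integral_norm]
    refine le_of_eq_of_le (integral_congr_ae ?_) (hsε i)
    filter_upwards [hsum i, Lp.coeFn_sub (F i) (∑ c ∈ s.range, c i • u c)] with ω h h'
    rw [h', Pi.sub_apply, h]
  have havg : ∀ i, ∀ c, ‖c i - a c i‖ * ‖u c‖ ≤ ∫ ω in s ⁻¹' {c}, ‖F i ω - s ω i‖ ∂μ := by
    intro i c
    rw [hunorm]
    rcases eq_or_ne (μ.real (s ⁻¹' {c})) 0 with h0 | h0
    · rw [h0, mul_zero]
      positivity
    have h0' : ((μ.real (s ⁻¹' {c}) : ℝ) : 𝕜) ≠ 0 := by exact_mod_cast h0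
    have h1 : (a c i - c i) * ((μ.real (s ⁻¹' {c}) : ℝ) : 𝕜)
        = ∫ ω in s ⁻¹' {c}, (F i ω - s ω i) ∂μ := by
      rw [integral_sub (hF i).integrableOn (hsint.eval i).integrableOn,
        setIntegral_congr_fun (f := fun ω => s ω i) (g := fun _ => c i) (s.measurableSet_fiber c)
          (fun ω (hω : s ω = c) => by simp only [hω]), setIntegral_const, ha]
      simp only [setAverage_eq, RCLike.real_smul_eq_coe_mul, RCLike.ofReal_inv]
      field_simp
    calc ‖c i - a c i‖ * μ.real (s ⁻¹' {c})
        = ‖(a c i - c i) * ((μ.real (s ⁻¹' {c}) : ℝ) : 𝕜)‖ := by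
          rw [norm_mul, RCLike.norm_ofReal, abs_of_nonneg measureReal_nonneg, norm_sub_rev]
      _ ≤ _ := by
          rw [h1]
          exact norm_integral_le_integral_norm _
  -- Main term with averages, plus two errors: `F i` against the simple function, and values against
  -- averages. Each costs `‖A‖ ‖e i‖ ε`, hence the factor 2.
  have hsplit : ∑ i, A (F i) (e i) = (∑ c ∈ s.range, ∑ i, a c i * A (u c) (e i))
      + ∑ i, (A (F i - ∑ c ∈ s.range, c i • u c) (e i)
        + ∑ c ∈ s.range, (c i - a c i) * A (u c) (e i)) := by
    rw [Finset.sum_comm, ← Finset.sum_add_distrib]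
    refine Finset.sum_congr rfl fun i _ => ?_
    rw [map_sub, map_sum, sub_apply, sum_apply]
    simp only [map_smul, smul_apply, smul_eq_mul, sub_mul, Finset.sum_sub_distrib]
    ring
  have hmass : ∑ c ∈ s.range, μ.real (s ⁻¹' {c}) = μ.real Set.univ := by
    simpa using sum_setIntegral_fiber s (integrable_const (1 : ℝ) (μ := μ))
  rw [hsplit]
  refine (norm_add_le _ _).trans (add_le_add ?_ (norm_sum_le_of_le _ fun i _ => ?_))
  · rw [← hmass, Finset.mul_sum]
    exact norm_sum_le_of_le _ fun c _ => hB _ (s.measurableSet_fiber c)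
  · have h1 : ‖A (F i - ∑ c ∈ s.range, c i • u c) (e i)‖ ≤ ‖A‖ * ‖e i‖ * ε := by
      calc _ ≤ ‖A‖ * ‖F i - ∑ c ∈ s.range, c i • u c‖ * ‖e i‖ := A.le_opNorm₂ _ _
        _ ≤ ‖A‖ * ε * ‖e i‖ := by gcongr; exact hdist i
        _ = _ := by ring
    have h2 : ‖∑ c ∈ s.range, (c i - a c i) * A (u c) (e i)‖ ≤ ‖A‖ * ‖e i‖ * ε := by
      calc _ ≤ ∑ c ∈ s.range, ‖A‖ * ‖e i‖ * ∫ ω in s ⁻¹' {c}, ‖F i ω - s ω i‖ ∂μ := by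
            refine norm_sum_le_of_le _ fun c _ => ?_
            rw [norm_mul]
            calc ‖c i - a c i‖ * ‖A (u c) (e i)‖ ≤ ‖c i - a c i‖ * (‖A‖ * ‖u c‖ * ‖e i‖) := by
                  gcongr; exact A.le_opNorm₂ _ _
              _ = ‖A‖ * ‖e i‖ * (‖c i - a c i‖ * ‖u c‖) := by ring
              _ ≤ _ := by gcongr; exact havg i c
        _ = ‖A‖ * ‖e i‖ * ∫ ω, ‖F i ω - s ω i‖ ∂μ := by
            have := sum_setIntegral_fiber s ((hF i).sub (hsint.eval i)).norm
            simp only [Pi.sub_apply] at this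
            rw [← Finset.mul_sum, this]
        _ ≤ _ := by gcongr; exact hsε i
    calc _ ≤ ‖A‖ * ‖e i‖ * ε + ‖A‖ * ‖e i‖ * ε := (norm_add_le _ _).trans (add_le_add h1 h2)
      _ = _ := by ring

lemma norm_sum_apply_le {H : Type*} [NormedAddCommGroup H] [NormedSpace 𝕜 H] {n : ℕ}
    (F : Fin n → Lp 𝕜 1 μ) (e : Fin n → H) (A : Lp 𝕜 1 μ →L[𝕜] StrongDual 𝕜 H) {B : ℝ}
    (hB : ∀ (S : Set Ω) (hS : MeasurableSet S),
      ‖∑ i, (⨍ ω in S, F i ω ∂μ) * A (indicatorConstLp 1 hS (measure_ne_top μ S) 1) (e i)‖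
        ≤ B * μ.real S) :
    ‖∑ i, A (F i) (e i)‖ ≤ B * μ.real Set.univ := by
  refine le_of_forall_pos_le_add fun δ hδ => ?_
  set D := ∑ i, ‖A‖ * ‖e i‖ with hD
  have hD0 : 0 ≤ D := Finset.sum_nonneg fun i _ => by positivity
  -- The `+ 1` keeps the denominator positive when `D = 0`.
  refine (norm_sum_apply_simple_approx F e A hB (ε := δ / (2 * (D + 1))) (by positivity)).trans ?_
  rw [← Finset.sum_mul, ← hD]
  gcongr
  rw [show D * (2 * (δ / (2 * (D + 1)))) = δ * (D / (D + 1)) by field_simp]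
  exact mul_le_of_le_one_right hδ.le ((div_le_one (by positivity)).2 (by linarith))

lemma coeFn_linftyToL1 (h : Lp 𝕜 ∞ μ) : ⇑(linftyToL1 μ h) =ᵐ[μ] h :=
  MemLp.coeFn_toLp _

end Forward

/-! ### A factorization gives the integral inequality -/

section Bound

variable {𝕜 : Type w} {X : Type u} {E : Type v} [RCLike 𝕜] [MetricSpace X]
  [NormedAddCommGroup E] [NormedSpace 𝕜 E] {o : X} {R : X → E}
  {Ω : Type (max u v w)} [MeasurableSpace Ω] {μ : Measure Ω} [IsFiniteMeasure μ]
  {g : X → Lp 𝕜 ∞ μ} {A : Lp 𝕜 1 μ →L[𝕜] StrongDual 𝕜 (StrongDual 𝕜 E)}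

set_option maxSynthPendingDepth 4 in
lemma IsGIFactorization.isIntegralBound (h : IsGIFactorization o R μ g A) :
    IsIntegralBound 𝕜 o (lipLinearForm 𝕜 R) (‖A‖ * μ.real Set.univ * lipNumber g) := by
  intro n x y e z
  set W := weakSup o x y e z with hW
  set F : Fin n → Lp 𝕜 1 μ := fun i => linftyToL1 μ (g (x i)) - linftyToL1 μ (g (y i)) with hF
  have hint : ∀ a, Integrable (g a) μ := fun a =>
    memLp_one_iff_integrable.1 ((Lp.memLp (g a)).mono_exponent le_top)
  -- Functionals on `𝕜` are multiplications by scalars, which can be absorbed into `e i`.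
  have hz : ∀ i (t : 𝕜), z i t = t * z i 1 := fun i t => by
    rw [← smul_eq_mul, ← map_smul, smul_eq_mul, mul_one]
  have hT : ∀ i, z i (lipLinearForm 𝕜 R (x i, e i) - lipLinearForm 𝕜 R (y i, e i))
      = A (F i) (z i 1 • e i) := by
    intro i
    rw [hz, hF, map_sub, ← h.2, ← h.2, map_smul, smul_eq_mul, mul_comm]
    simp [lipLinearForm]
  simp_rw [hT]
  have key := norm_sum_apply_le F (fun i => z i 1 • e i) A (B := lipNumber g * ‖A‖ * W) ?_
  · linarith
  intro S hS
  rcases eq_or_ne (μ.real S) 0 with h0 | h0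
  · have : indicatorConstLp 1 hS (measure_ne_top μ S) (1 : 𝕜) = 0 := by
      rw [← norm_eq_zero, norm_indicatorConstLp one_ne_zero ENNReal.one_ne_top]
      simp [h0]
    simp [this, h0]
  have h0' : ((μ.real S : ℝ) : 𝕜) ≠ 0 := by exact_mod_cast h0
  -- The competitors attached to `S`; dividing by `μ(S)` is why null sets were treated apart.
  set f : X → 𝕜 := fun a => ⨍ ω in S, g a ω ∂μ with hf
  set φ : StrongDual 𝕜 (StrongDual 𝕜 E) :=
    ((μ.real S : ℝ) : 𝕜)⁻¹ • A (indicatorConstLp 1 hS (measure_ne_top μ S) 1) with hφ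
  have hfsub : ∀ a b, f a - f b = (μ.real S)⁻¹ • ∫ ω in S, (g a - g b : Lp 𝕜 ∞ μ) ω ∂μ := by
    intro a b
    rw [setIntegral_congr_ae hS ((Lp.coeFn_sub (g a) (g b)).mono fun ω hω _ => hω)]
    simp only [hf, setAverage_eq, Pi.sub_apply]
    rw [integral_sub (hint a).integrableOn (hint b).integrableOn, smul_sub]
  have hf0 : f o = 0 := by
    simp only [hf, setAverage_eq, h.1.2]
    rw [setIntegral_congr_ae hS ((Lp.coeFn_zero 𝕜 ∞ μ).mono fun ω hω _ => hω)]
    simp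
  have hflip : ∀ a b, ‖f a - f b‖ ≤ lipNumber g * dist a b := by
    intro a b
    rw [hfsub, norm_smul, norm_inv, Real.norm_of_nonneg measureReal_nonneg,
      inv_mul_le_iff₀ (lt_of_le_of_ne measureReal_nonneg h0.symm), mul_comm]
    refine (norm_setIntegral_le_of_norm_le_const_ae (measure_lt_top μ S)
      (ae_restrict_of_ae (ae_norm_le_norm_Lp_top (g a - g b)))).trans ?_
    gcongr
    exact norm_sub_le_lipNumber_mul h.1.1 a b
  have hφn : ‖φ‖ ≤ ‖A‖ := by
    rw [hφ, norm_smul, norm_inv, RCLike.norm_ofReal, abs_of_nonneg measureReal_nonneg,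
      inv_mul_le_iff₀ (lt_of_le_of_ne measureReal_nonneg h0.symm), mul_comm]
    refine (A.le_opNorm _).trans_eq ?_
    rw [norm_indicatorConstLp one_ne_zero ENNReal.one_ne_top]
    simp
  have hle := norm_sum_le_mul_weakSup o x y e z (lipNumber_nonneg g) hf0 hflip hφn
  have hFa : ∀ i, ⨍ ω in S, F i ω ∂μ = f (x i) - f (y i) := by
    intro i
    rw [hfsub, setAverage_eq]
    congr 1
    refine setIntegral_congr_ae hS ?_
    filter_upwards [Lp.coeFn_sub (linftyToL1 μ (g (x i))) (linftyToL1 μ (g (y i))),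
      coeFn_linftyToL1 (g (x i)), coeFn_linftyToL1 (g (y i)), Lp.coeFn_sub (g (x i)) (g (y i))]
      with ω h1 h2 h3 h4 _
    rw [h1, h4, Pi.sub_apply, Pi.sub_apply, h2, h3]
  calc _ = ‖((μ.real S : ℝ) : 𝕜) * (∑ i, ((f (x i) - f (y i)) * φ (e i)) • z i) 1‖ := by
        rw [sum_apply, Finset.mul_sum]
        congr 1
        refine Finset.sum_congr rfl fun i _ => ?_
        rw [hFa, hφ]
        simp only [smul_apply, smul_eq_mul, map_smul]
        field_simp
    _ ≤ μ.real S * ‖∑ i, ((f (x i) - f (y i)) * φ (e i)) • z i‖ := by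
        rw [norm_mul, RCLike.norm_ofReal, abs_of_nonneg measureReal_nonneg]
        gcongr
        simpa using (∑ i, ((f (x i) - f (y i)) * φ (e i)) • z i).le_opNorm 1
    _ ≤ μ.real S * (lipNumber g * ‖A‖ * W) := by gcongr
    _ = _ := by ring

end Bound

/-! ### Pietsch-type domination by Hahn–Banach and Riesz -/

section Domination

variable {𝕜 K V : Type*} [RCLike 𝕜] [TopologicalSpace K] [CompactSpace K]
  [AddCommGroup V] [Module 𝕜 V] {J : V →ₗ[𝕜] C(K, 𝕜)} {Λ : V →ₗ[𝕜] 𝕜} {C : ℝ}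

/-- If `|Λ v| ≤ C ‖J v‖` in `C(K)`, there is a positive functional `M` on `C(K, ℝ)` of norm at most
`C` with `|Λ v| ≤ M |J v|`. -/
lemma exists_linearMap_dominating (hC : 0 ≤ C) (hΛ : ∀ v, ‖Λ v‖ ≤ C * ‖J v‖) :
    ∃ M : C(K, ℝ) →ₗ[ℝ] ℝ, (∀ f, M f ≤ C * ‖f‖) ∧
      ∀ (h : C(K, ℝ)) (v : V), (∀ k, ‖J v k‖ ≤ h k) → ‖Λ v‖ ≤ M h := by
  let S := {s : C(K, ℝ) × V // ∀ k, ‖J s.2 k‖ ≤ s.1 k}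
  let a : C(K, ℝ) → S → ℝ := fun f s => C * ‖f + s.1.1‖ - RCLike.re (Λ s.1.2)
  -- A linear `M ≤ p` does everything: the pair `(0, 0)` gives `M f ≤ C ‖f‖`, and testing `-h`
  -- against `(h, v)` kills the norm term and gives `re (Λ v) ≤ M h`.
  let p : C(K, ℝ) → ℝ := fun f => ⨅ s : S, a f s
  have : Nonempty S := ⟨⟨(0, 0), by simp⟩⟩
  have hlb : ∀ f s, -(C * ‖f‖) ≤ a f s := by
    intro f s
    have h1 : RCLike.re (Λ s.1.2) ≤ C * ‖s.1.1‖ := by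
      refine (RCLike.re_le_norm _).trans ((hΛ _).trans ?_)
      gcongr
      refine (ContinuousMap.norm_le _ (norm_nonneg _)).2 fun k => (s.2 k).trans ?_
      exact (le_abs_self _).trans (s.1.1.norm_coe_le_norm k)
    have h2 : ‖s.1.1‖ ≤ ‖f + s.1.1‖ + ‖f‖ := by
      simpa using norm_sub_le (f + s.1.1) f
    have h3 := mul_le_mul_of_nonneg_left h2 hC
    simp only [a]
    linarith
  have hbdd : ∀ f, BddBelow (Set.range (a f)) := fun f =>
    ⟨-(C * ‖f‖), by rintro _ ⟨s, rfl⟩; exact hlb f s⟩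
  have hple : ∀ f s, p f ≤ a f s := fun f s => ciInf_le (hbdd f) s
  have hhom' : ∀ c : ℝ, 0 < c → ∀ f, p (c • f) ≤ c * p f := by
    intro c hc f
    rw [← inv_mul_le_iff₀ hc]
    refine le_ciInf fun s => ?_
    rw [inv_mul_le_iff₀ hc]
    refine (hple (c • f) ⟨(c • s.1.1, (c : 𝕜) • s.1.2), fun k => ?_⟩).trans_eq ?_
    · simpa [norm_smul, abs_of_pos hc] using mul_le_mul_of_nonneg_left (s.2 k) hc.le
    · simp only [a]
      rw [← smul_add, norm_smul, map_smul, smul_eq_mul, RCLike.re_ofReal_mul, Real.norm_of_nonneg hc.le]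
      ring
  have hhom : ∀ c : ℝ, 0 < c → ∀ f, p (c • f) = c * p f := by
    intro c hc f
    refine le_antisymm (hhom' c hc f) ?_
    rw [← le_inv_mul_iff₀ hc]
    simpa [smul_smul, inv_mul_cancel₀ hc.ne'] using hhom' c⁻¹ (inv_pos.2 hc) (c • f)
  have hadd : ∀ f₁ f₂, p (f₁ + f₂) ≤ p f₁ + p f₂ := by
    intro f₁ f₂
    have key : ∀ s t : S, p (f₁ + f₂) ≤ a f₁ s + a f₂ t := by
      intro s t
      refine (hple (f₁ + f₂) ⟨(s.1.1 + t.1.1, s.1.2 + t.1.2), fun k => ?_⟩).trans ?_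
      · simpa using (norm_add_le _ _).trans (add_le_add (s.2 k) (t.2 k))
      · have h1 : ‖f₁ + f₂ + (s.1.1 + t.1.1)‖ ≤ ‖f₁ + s.1.1‖ + ‖f₂ + t.1.1‖ := by
          rw [add_add_add_comm]; exact norm_add_le _ _
        have h2 := mul_le_mul_of_nonneg_left h1 hC
        simp only [a, map_add]
        linarith
    have h1 : ∀ t, p (f₁ + f₂) - a f₂ t ≤ p f₁ := fun t => le_ciInf fun s => by
      linarith [key s t]
    have h2 : p (f₁ + f₂) - p f₁ ≤ p f₂ := le_ciInf fun t => by linarith [h1 t]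
    linarith
  obtain ⟨M, -, hM⟩ := exists_extension_of_le_sublinear (⟨⊥, 0⟩ : C(K, ℝ) →ₗ.[ℝ] ℝ) p hhom hadd
    (by
      rintro ⟨x, hx⟩
      obtain rfl : x = 0 := hx
      exact le_ciInf fun s => by simpa using hlb 0 s)
  have hre : ∀ (h : C(K, ℝ)) (v : V), (∀ k, ‖J v k‖ ≤ h k) → RCLike.re (Λ v) ≤ M h := by
    intro h v hv
    have h1 := (hM (-h)).trans (hple (-h) ⟨(h, v), hv⟩)
    simp only [a, map_neg, neg_add_cancel, norm_zero, mul_zero, zero_sub] at h1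
    linarith
  refine ⟨M, fun f => ?_, fun h v hv => ?_⟩
  · simpa [a] using (hM f).trans (hple f ⟨(0, 0), by simp⟩)
  -- Rotating `v` by a unimodular scalar turns the real part into the modulus.
  · obtain ⟨c, hc, hcv⟩ := RCLike.exists_norm_eq_mul_self (Λ v)
    have := hre h (c • v) fun k => by simpa [norm_smul, hc] using hv k
    rwa [map_smul, smul_eq_mul, ← hcv, RCLike.ofReal_re] at this

variable [T2Space K] [MeasurableSpace K] [BorelSpace K]

open scoped CompactlySupported in
lemma exists_measure_dominating (hC : 0 ≤ C) (hΛ : ∀ v, ‖Λ v‖ ≤ C * ‖J v‖) :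
    ∃ μ : Measure K, IsFiniteMeasure μ ∧ μ.real Set.univ ≤ C ∧
      ∀ v, ‖Λ v‖ ≤ ∫ k, ‖J v k‖ ∂μ := by
  obtain ⟨M, hMC, hM⟩ := exists_linearMap_dominating hC hΛ
  -- Positivity of `M` is its domination property at `v = 0`.
  let M' : C_c(K, ℝ) →ₚ[ℝ] ℝ := PositiveLinearMap.mk₀
    { toFun := fun f => M f.toContinuousMap
      map_add' := fun f g => M.map_add f.toContinuousMap g.toContinuousMap
      map_smul' := fun c f => M.map_smul c f.toContinuousMap }
    (fun f hf => by simpa using hM f.toContinuousMap 0 fun k => by simpa using hf k)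
  have hint : ∀ f : C(K, ℝ), ∫ k, f k ∂(RealRMK.rieszMeasure M') = M f := fun f =>
    RealRMK.integral_rieszMeasure M' (CompactlySupportedContinuousMap.continuousMapEquiv f)
  have hfin : IsFiniteMeasure (RealRMK.rieszMeasure M') := inferInstance
  refine ⟨RealRMK.rieszMeasure M', hfin, ?_, fun v => ?_⟩
  · have h1 : (RealRMK.rieszMeasure M').real Set.univ = M 1 := by
      rw [← hint]; simp
    rw [h1]
    refine (hMC 1).trans (mul_le_of_le_one_right hC ?_)
    exact (ContinuousMap.norm_le _ zero_le_one).2 fun k => by simp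
  · have h1 := hint ⟨fun k => ‖J v k‖, by fun_prop⟩
    simp only [ContinuousMap.coe_mk] at h1
    rw [h1]
    exact hM _ v fun k => le_rfl

end Domination

/-- The inequality forces `ker S ⊆ ker Λ`, so `Λ` descends to a contraction on the range of `S`;
Hahn–Banach extends it. -/
lemma exists_strongDual_comp_eq {𝕜 V N : Type*} [RCLike 𝕜] [AddCommGroup V] [Module 𝕜 V]
    [NormedAddCommGroup N] [NormedSpace 𝕜 N] (S : V →ₗ[𝕜] N) (Λ : V →ₗ[𝕜] 𝕜)
    (h : ∀ v, ‖Λ v‖ ≤ ‖S v‖) : ∃ ψ : StrongDual 𝕜 N, ‖ψ‖ ≤ 1 ∧ ∀ v, ψ (S v) = Λ v := by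
  obtain ⟨σ, hσ⟩ := S.rangeRestrict.exists_rightInverse_of_surjective S.range_rangeRestrict
  have hSσ : ∀ y : LinearMap.range S, S (σ y) = y := fun y =>
    congrArg Subtype.val (LinearMap.congr_fun hσ y)
  let ψ₀ : StrongDual 𝕜 (LinearMap.range S) := (Λ ∘ₗ σ).mkContinuous 1 fun y => by
    rw [one_mul, LinearMap.comp_apply]
    refine (h _).trans_eq ?_
    rw [hSσ, Submodule.coe_norm]
  obtain ⟨ψ, hψ, hn⟩ := exists_extension_norm_eq (LinearMap.range S) ψ₀
  refine ⟨ψ, hn.trans_le (LinearMap.mkContinuous_norm_le _ zero_le_one _), fun v => ?_⟩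
  rw [show ψ (S v) = ψ₀ (S.rangeRestrict v) from hψ (S.rangeRestrict v)]
  change Λ (σ (S.rangeRestrict v)) = Λ v
  rw [← sub_eq_zero, ← map_sub, ← norm_le_zero_iff]
  refine (h _).trans_eq ?_
  rw [map_sub, hSσ]
  exact norm_eq_zero.2 (sub_self (S v))

/-! ### Building the factorization from the dominating measure -/

section Factor

variable {𝕜 : Type w} {X : Type u} {E : Type v} [RCLike 𝕜] [MetricSpace X]
  [NormedAddCommGroup E] [NormedSpace 𝕜 E] {o : X} {R : X → E} {C : ℝ}

lemma norm_toLp_top_le {K : Type*} [TopologicalSpace K] [CompactSpace K] [MeasurableSpace K]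
    [BorelSpace K] (μ : Measure K) [IsFiniteMeasure μ] (h : C(K, 𝕜)) :
    ‖ContinuousMap.toLp ∞ μ 𝕜 h‖ ≤ ‖h‖ := by
  have h1 := (ContinuousMap.toLp ∞ μ 𝕜 (E := 𝕜)).le_of_opNorm_le
    (ContinuousMap.toLp_norm_le (p := ∞) (μ := μ) (𝕜 := 𝕜) (E := 𝕜)) h
  simpa using h1

set_option maxSynthPendingDepth 4 in
lemma exists_isGIFactorization_of_compact {K : Type (max u v w)} [TopologicalSpace K]
    [CompactSpace K] [T2Space K] (f : X → C(K, 𝕜)) (φ : StrongDual 𝕜 E →ₗ[𝕜] C(K, 𝕜))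
    (hf0 : f o = 0) (hf : ∀ x y, ‖f x - f y‖ ≤ dist x y) (hφ : ∀ e, ‖φ e‖ ≤ ‖e‖) (hC : 0 ≤ C)
    (h : ∀ v : X × StrongDual 𝕜 E →₀ 𝕜,
      ‖Finsupp.linearCombination 𝕜 (fun p : X × StrongDual 𝕜 E => p.2 (R p.1)) v‖ ≤
        C * ‖Finsupp.linearCombination 𝕜 (fun p : X × StrongDual 𝕜 E => f p.1 * φ p.2) v‖) :
    ∃ (Ω : Type (max u v w)) (_ : MeasurableSpace Ω) (μ : Measure Ω) (_ : IsFiniteMeasure μ)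
      (g : X → Lp 𝕜 ∞ μ) (A : Lp 𝕜 1 μ →L[𝕜] StrongDual 𝕜 (StrongDual 𝕜 E)),
      IsGIFactorization o R μ g A ∧ ‖A‖ * μ.real Set.univ * lipNumber g ≤ C := by
  let _ : MeasurableSpace K := borel K
  have _ : BorelSpace K := ⟨rfl⟩
  obtain ⟨μ, hμ, hμC, hdom⟩ := exists_measure_dominating hC h
  obtain ⟨ψ, hψ1, hψ⟩ := exists_strongDual_comp_eq
    ((ContinuousMap.toLp 1 μ 𝕜).toLinearMap ∘ₗ
      Finsupp.linearCombination 𝕜 (fun p : X × StrongDual 𝕜 E => f p.1 * φ p.2))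
    (Finsupp.linearCombination 𝕜 (fun p : X × StrongDual 𝕜 E => p.2 (R p.1))) (by
      intro v
      refine (hdom v).trans_eq ?_
      rw [LinearMap.comp_apply, L1.norm_eq_integral_norm]
      refine integral_congr_ae ?_
      filter_upwards [ContinuousMap.coeFn_toLp (p := 1) (𝕜 := 𝕜) μ
        (Finsupp.linearCombination 𝕜 (fun p : X × StrongDual 𝕜 E => f p.1 * φ p.2) v)] with k hk
      exact congrArg norm hk.symm)
  -- Hölder multiplication L₁ × L_∞ → L₁, through which `ψ` defines `A`.
  let m : Lp 𝕜 1 μ →L[𝕜] Lp 𝕜 ∞ μ →L[𝕜] Lp 𝕜 1 μ :=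
    (ContinuousLinearMap.mul 𝕜 𝕜).holderL μ 1 ∞ 1
  have hm : ∀ k l, ‖m k l‖ ≤ ‖k‖ * ‖l‖ := fun k l => by
    have h1 : ‖m‖ ≤ 1 := ((ContinuousLinearMap.mul 𝕜 𝕜).norm_holderL_le).trans (by simp)
    calc ‖m k l‖ ≤ ‖m‖ * ‖k‖ * ‖l‖ := m.le_opNorm₂ k l
      _ ≤ 1 * ‖k‖ * ‖l‖ := by gcongr
      _ = ‖k‖ * ‖l‖ := by ring
  let A : Lp 𝕜 1 μ →L[𝕜] StrongDual 𝕜 (StrongDual 𝕜 E) :=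
    (LinearMap.mk₂ 𝕜 (fun k e => ψ (m k (ContinuousMap.toLp ∞ μ 𝕜 (φ e))))
      (by simp) (by simp) (by simp) (by simp)).mkContinuous₂ 1 fun k e => by
        rw [LinearMap.mk₂_apply, one_mul]
        calc _ ≤ 1 * ‖m k (ContinuousMap.toLp ∞ μ 𝕜 (φ e))‖ := ψ.le_of_opNorm_le hψ1 _
          _ ≤ ‖k‖ * ‖ContinuousMap.toLp ∞ μ 𝕜 (φ e)‖ := by rw [one_mul]; exact hm _ _
          _ ≤ ‖k‖ * ‖e‖ := by
            gcongr
            exact (norm_toLp_top_le μ _).trans (hφ e)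
  have hA : ‖A‖ ≤ 1 := LinearMap.mkContinuous₂_norm_le _ zero_le_one _
  let g : X → Lp 𝕜 ∞ μ := fun x => ContinuousMap.toLp ∞ μ 𝕜 (f x)
  have hg : ∀ x y, ‖g x - g y‖ ≤ 1 * dist x y := fun x y => by
    rw [one_mul, ← map_sub]
    exact (norm_toLp_top_le μ _).trans (hf x y)
  refine ⟨K, inferInstance, μ, hμ, g, A, ⟨⟨⟨1, ?_⟩, ?_⟩, fun x => ?_⟩, ?_⟩
  · exact LipschitzWith.of_dist_le_mul fun x y => by simpa [dist_eq_norm] using hg x y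
  · simp [g, hf0]
  -- On the generator `(x, e)`, `ψ` takes the value `e (R x)`, and the class of `f x * φ e` in L₁ is
  -- the product used in `A`.
  · ext e
    have h1 := hψ (Finsupp.single (x, e) 1)
    rw [LinearMap.comp_apply, Finsupp.linearCombination_single,
      Finsupp.linearCombination_single, one_smul, one_smul] at h1
    rw [NormedSpace.dual_def, ← h1]
    change ψ _ = ψ _
    congr 1
    refine Lp.ext ?_
    filter_upwards [ContinuousMap.coeFn_toLp (p := 1) (𝕜 := 𝕜) μ (f x * φ e),
      ContinuousMap.coeFn_toLp (p := ∞) (𝕜 := 𝕜) μ (f x),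
      ContinuousMap.coeFn_toLp (p := ∞) (𝕜 := 𝕜) μ (φ e),
      coeFn_linftyToL1 (μ := μ) (ContinuousMap.toLp ∞ μ 𝕜 (f x)),
      (ContinuousLinearMap.mul 𝕜 𝕜).coeFn_holder (r := 1)
        (linftyToL1 μ (ContinuousMap.toLp ∞ μ 𝕜 (f x))) (ContinuousMap.toLp ∞ μ 𝕜 (φ e))]
      with k h1 h2 h3 h4 h5
    refine h1.trans (Eq.trans ?_ h5.symm)
    rw [h3, h4, h2]
    rfl
  · calc ‖A‖ * μ.real Set.univ * lipNumber g ≤ 1 * C * 1 := by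
          have := lipNumber_nonneg g
          have := lipNumber_le zero_le_one hg
          gcongr
      _ = C := by ring

end Factor

/-- The closed unit ball of `X^#`, with the topology of pointwise convergence. -/
abbrev LipBall (𝕜 : Type*) {X : Type*} [RCLike 𝕜] [MetricSpace X] (o : X) : Type _ :=
  {f : X → 𝕜 // f o = 0 ∧ LipschitzWith 1 f}

/-- Tychonoff: a closed subset of the product over `x` of the closed balls of radius `dist x o`. -/
instance {𝕜 X : Type*} [RCLike 𝕜] [MetricSpace X] (o : X) : CompactSpace (LipBall 𝕜 o) := by
  refine (isCompact_iff_compactSpace (s := {f : X → 𝕜 | f o = 0 ∧ LipschitzWith 1 f})).1 ?_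
  refine (isCompact_univ_pi fun x => isCompact_closedBall (0 : 𝕜) (dist x o)).of_isClosed_subset
    ?_ ?_
  · have : {f : X → 𝕜 | f o = 0 ∧ LipschitzWith 1 f} =
        {f | f o = 0} ∩ ⋂ x, ⋂ y, {f | dist (f x) (f y) ≤ dist x y} := by
      ext f
      simp [lipschitzWith_iff_dist_le_mul]
    rw [this]
    refine (isClosed_eq (continuous_apply o) continuous_const).inter
      (isClosed_iInter fun x => isClosed_iInter fun y => ?_)
    exact isClosed_le ((continuous_apply x).dist (continuous_apply y)) continuous_const
  · rintro f ⟨h0, hf⟩ x -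
    simpa [h0] using hf.dist_le_mul x o

/-- The closed unit ball of the dual space, with the weak-* topology. -/
abbrev WeakDualBall (𝕜 G : Type*) [RCLike 𝕜] [NormedAddCommGroup G] [NormedSpace 𝕜 G] : Type _ :=
  WeakDual.toStrongDual ⁻¹' Metric.closedBall (0 : StrongDual 𝕜 G) 1

instance {𝕜 G : Type*} [RCLike 𝕜] [NormedAddCommGroup G] [NormedSpace 𝕜 G] :
    CompactSpace (WeakDualBall 𝕜 G) :=
  isCompact_iff_compactSpace.1 (WeakDual.isCompact_closedBall 0 1)

/-! ### The integral inequality gives a factorization -/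

section Converse

variable {𝕜 : Type w} {X : Type u} {E : Type v} [RCLike 𝕜] [MetricSpace X]
  [NormedAddCommGroup E] [NormedSpace 𝕜 E] {o : X} {R : X → E} {C : ℝ}

lemma apply_base_eq_zero (h : IsLipLinearZero 𝕜 o (lipLinearForm 𝕜 R)) : R o = 0 :=
  SeparatingDual.eq_zero_of_forall_dual_eq_zero (R := 𝕜) h.2.2

/-- Evaluation of Lipschitz functions, on the product of the two balls. -/
def evalLip (𝕜 : Type*) {X : Type*} [RCLike 𝕜] [MetricSpace X] (o : X) (G : Type*)
    [NormedAddCommGroup G] [NormedSpace 𝕜 G] (x : X) : C(LipBall 𝕜 o × WeakDualBall 𝕜 G, 𝕜) where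
  toFun k := k.1.1 x
  continuous_toFun := (continuous_apply x).comp (continuous_subtype_val.comp continuous_fst)

/-- Evaluation of functionals, on the product of the two balls. -/
noncomputable def evalDual (𝕜 : Type*) {X : Type*} [RCLike 𝕜] [MetricSpace X] (o : X) (G : Type*)
    [NormedAddCommGroup G] [NormedSpace 𝕜 G] :
    G →ₗ[𝕜] C(LipBall 𝕜 o × WeakDualBall 𝕜 G, 𝕜) where
  toFun e :=
    { toFun := fun k => k.2.1 e
      continuous_toFun :=
        (WeakDual.eval_continuous e).comp (continuous_subtype_val.comp continuous_snd) }
  map_add' e e' := by ext k; exact map_add k.2.1 e e'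
  map_smul' c e := by ext k; exact map_smul k.2.1 c e

lemma norm_linearCombination_le (hR : R o = 0) (hC : 0 ≤ C)
    (h : IsIntegralBound 𝕜 o (lipLinearForm 𝕜 R) C) (v : X × StrongDual 𝕜 E →₀ 𝕜) :
    ‖Finsupp.linearCombination 𝕜 (fun p : X × StrongDual 𝕜 E => p.2 (R p.1)) v‖ ≤
      C * ‖Finsupp.linearCombination 𝕜 (fun p : X × StrongDual 𝕜 E =>
        evalLip 𝕜 o (StrongDual 𝕜 E) p.1 * evalDual 𝕜 o (StrongDual 𝕜 E) p.2) v‖ := by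
  let s := v.support.equivFin.symm
  let z : Fin v.support.card → StrongDual 𝕜 𝕜 := fun i =>
    v (s i : X × StrongDual 𝕜 E) • ContinuousLinearMap.id 𝕜 𝕜
  have hsum : ∀ a : X × StrongDual 𝕜 E → 𝕜, ∑ p ∈ v.support, a p = ∑ i, a (s i) := fun a => by
    rw [← Finset.sum_coe_sort v.support a]
    exact (Equiv.sum_comp s fun p => a p).symm
  -- Only differences with the base point are needed, since `R o = 0`; the coefficients of `v` are
  -- carried by the `z i`.
  have key := h v.support.card (fun i => (s i : X × StrongDual 𝕜 E).1) (fun _ => o)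
    (fun i => (s i : X × StrongDual 𝕜 E).2) z
  refine le_of_eq_of_le ?_ (key.trans (mul_le_mul_of_nonneg_left ?_ hC))
  · rw [Finsupp.linearCombination_apply, Finsupp.sum, hsum]
    simp [z, lipLinearForm, hR]
  · refine Real.sSup_le ?_ (norm_nonneg _)
    rintro r ⟨f, φ, hf0, hf, hφ, rfl⟩
    let k : LipBall 𝕜 o × WeakDualBall 𝕜 (StrongDual 𝕜 E) :=
      (⟨f, hf0, hf⟩, ⟨StrongDual.toWeakDual φ, by simpa using hφ.le⟩)
    refine ContinuousLinearMap.opNorm_le_bound _ (norm_nonneg _) fun t => ?_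
    refine le_of_eq_of_le ?_ (mul_le_mul_of_nonneg_right (ContinuousMap.norm_coe_le_norm _ k)
      (norm_nonneg t))
    rw [← norm_mul, Finsupp.linearCombination_apply, Finsupp.sum, ContinuousMap.sum_apply, hsum,
      sum_apply, Finset.sum_mul]
    congr 1
    refine Finset.sum_congr rfl fun i _ => ?_
    simp only [z, hf0, sub_zero, smul_apply, ContinuousMap.smul_apply, ContinuousMap.mul_apply,
      smul_eq_mul, ContinuousLinearMap.id_apply]
    change _ = v (s i) * (f (s i : X × StrongDual 𝕜 E).1 * φ (s i : X × StrongDual 𝕜 E).2) * t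
    ring

set_option maxSynthPendingDepth 4 in
lemma exists_isGIFactorization (hR : R o = 0) (hC : 0 ≤ C)
    (h : IsIntegralBound 𝕜 o (lipLinearForm 𝕜 R) C) :
    ∃ (Ω : Type (max u v w)) (_ : MeasurableSpace Ω) (μ : Measure Ω) (_ : IsFiniteMeasure μ)
      (g : X → Lp 𝕜 ∞ μ) (A : Lp 𝕜 1 μ →L[𝕜] StrongDual 𝕜 (StrongDual 𝕜 E)),
      IsGIFactorization o R μ g A ∧ ‖A‖ * μ.real Set.univ * lipNumber g ≤ C := by
  refine exists_isGIFactorization_of_compact (evalLip 𝕜 o (StrongDual 𝕜 E))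
    (evalDual 𝕜 o (StrongDual 𝕜 E)) ?_ ?_ ?_ hC (norm_linearCombination_le hR hC h)
  · ext k; exact k.1.2.1
  · intro x y
    refine (ContinuousMap.norm_le _ dist_nonneg).2 fun k => ?_
    simpa [dist_eq_norm] using! k.1.2.2.dist_le_mul x y
  · intro e
    refine (ContinuousMap.norm_le _ (norm_nonneg _)).2 fun k => ?_
    have hk : ‖WeakDual.toStrongDual k.2.1‖ ≤ 1 := mem_closedBall_zero_iff.1 k.2.2
    simpa using! (WeakDual.toStrongDual k.2.1).le_of_opNorm_le hk e

end Converse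

lemma isLipLinearZero_lipLinearForm {𝕜 X E : Type*} [RCLike 𝕜] [MetricSpace X]
    [NormedAddCommGroup E] [NormedSpace 𝕜 E] {o : X} {R : X → E} (hR : IsLipZero o R) :
    IsLipLinearZero 𝕜 o (lipLinearForm 𝕜 R) := by
  obtain ⟨⟨K, hK⟩, h0⟩ := hR
  refine ⟨⟨K + 1, by positivity, fun x y e => ?_⟩, fun x => ⟨fun e e' => rfl, fun c e => rfl⟩,
    fun e => ?_⟩
  · simp only [lipLinearForm]
    rw [← map_sub]
    calc ‖e (R x - R y)‖ ≤ ‖e‖ * ‖R x - R y‖ := e.le_opNorm _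
      _ ≤ ‖e‖ * (K * dist x y) := by
        gcongr
        rw [← dist_eq_norm]
        exact hK.dist_le_mul x y
      _ ≤ ‖e‖ * ((K + 1) * dist x y) := by gcongr; linarith
      _ = _ := by ring
  · simp [lipLinearForm, h0]

lemma IsIntegralBound.mono {𝕜 X E F : Type*} [RCLike 𝕜] [MetricSpace X]
    [NormedAddCommGroup E] [NormedSpace 𝕜 E] [NormedAddCommGroup F] [NormedSpace 𝕜 F]
    {o : X} {T : X × E → F} {C D : ℝ} (h : IsIntegralBound 𝕜 o T C) (hCD : C ≤ D) :
    IsIntegralBound 𝕜 o T D := fun n x y e z =>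
  (h n x y e z).trans (mul_le_mul_of_nonneg_right hCD (weakSup_nonneg o x y e z))

end LipLin

/-! ### The equivalence and equality of norms -/

set_option maxSynthPendingDepth 4 in
theorem mainTheorem5 {𝕜 : Type w} {X : Type u} {E : Type v} [RCLike 𝕜] [MetricSpace X] (o : X)
    [NormedAddCommGroup E] [NormedSpace 𝕜 E] [CompleteSpace E]
    (R : X → E) (hR : ∃ K, LipschitzWith K R) :
    (LipLin.IsLipGI 𝕜 o R ↔ LipLin.IsIntegral 𝕜 o (LipLin.lipLinearForm 𝕜 R)) ∧
      (LipLin.IsLipGI 𝕜 o R →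
        LipLin.lipGINorm 𝕜 o R = LipLin.integralNorm 𝕜 o (LipLin.lipLinearForm 𝕜 R)) := by
  have hpos : ∀ {Ω : Type (max u v w)} [MeasurableSpace Ω] (μ : Measure Ω) [IsFiniteMeasure μ]
      (g : X → Lp 𝕜 ∞ μ) (A : Lp 𝕜 1 μ →L[𝕜] StrongDual 𝕜 (StrongDual 𝕜 E)),
      0 ≤ ‖A‖ * μ.real Set.univ * LipLin.lipNumber g := fun μ _ g A =>
    mul_nonneg (by positivity) (LipLin.lipNumber_nonneg g)
  have forward : LipLin.IsLipGI 𝕜 o R → LipLin.IsIntegral 𝕜 o (LipLin.lipLinearForm 𝕜 R) := by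
    rintro ⟨hR0, Ω, _, μ, _, g, A, hfac⟩
    exact ⟨LipLin.isLipLinearZero_lipLinearForm hR0,
      ‖A‖ * μ.real Set.univ * LipLin.lipNumber g + 1, by linarith [hpos μ g A],
      hfac.isIntegralBound.mono (by linarith)⟩
  refine ⟨⟨forward, ?_⟩, fun hGI => le_antisymm ?_ ?_⟩
  · rintro ⟨hT, C, hC, hb⟩
    have h0 := LipLin.apply_base_eq_zero hT
    obtain ⟨Ω, i, μ, i', g, A, hfac, -⟩ := LipLin.exists_isGIFactorization h0 hC.le hb
    exact ⟨⟨hR, h0⟩, Ω, i, μ, i', g, A, hfac⟩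
  · obtain ⟨hT, C, hC, hb⟩ := forward hGI
    refine le_csInf ⟨C, hC, hb⟩ ?_
    rintro D ⟨hD, hbD⟩
    obtain ⟨Ω, i, μ, i', g, A, hfac, hle⟩ :=
      LipLin.exists_isGIFactorization (LipLin.apply_base_eq_zero hT) hD.le hbD
    refine le_trans (csInf_le ⟨0, ?_⟩ ⟨Ω, i, μ, i', g, A, hfac, rfl⟩) hle
    rintro c ⟨Ω, _, μ, _, g, A, -, rfl⟩
    exact hpos μ g A
  · obtain ⟨-, Ω, i, μ, i', g, A, hfac⟩ := hGI
    refine le_csInf ⟨_, Ω, i, μ, i', g, A, hfac, rfl⟩ ?_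
    rintro c ⟨Ω, _, μ, _, g, A, hfac, rfl⟩
    -- Integral constants must be positive while the factorization constant may be `0`, hence the
    -- added `ε`.
    refine le_of_forall_pos_le_add fun ε hε => csInf_le ⟨0, fun D hD => hD.1.le⟩ ⟨?_, ?_⟩
    · linarith [hpos μ g A]
    · exact hfac.isIntegralBound.mono (by linarith)
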